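/- Let $H(\mathbb{C})$ be the space of entire functions with the topology of uniform convergence on compact sets, and let $D$ be the differentiation operator on it. For a polynomial $P(z)=\sum_j c_jz^j$ put $P(D)=\sum_j c_jD^j$. A set $U\subset\mathbb{C}$ is called an $\mathcal{E}$-unicity set if every entire function $f$ of exponential type (that is, $|f(z)|\le Ae^{B|z|}$ for all $z\in\mathbb{C}$, with some constants $A,B>0$) that vanishes on $U$ is identically zero. Let $P_n(z)=\sum_{j=m(n)}^{d(n)}c_{j,n}z^j$ $(n\ge 1)$ be a sequence of nonconstant complex polynomials, where $c_{m(n),n}\ne 0\ne c_{d(n),n}$, so that $m(n)\ge 0$ is the valence of $P_n$ (its order of vanishing at the origin) and $d(n)\geq 1$ its degree; put $c_{j,n}=0$ for $j>d(n)$. Assume that the sequence $(m(n))$ is unbounded and that at least one of the following properties holds: - (P) There is an $\mathcal{E}$-unicity set $U\subset\mathbb{C}$ such that $\lim_{n\to\infty}|P_n(z)|=+\infty$ for all $z\in U$. - (Q) For each integer $k\ge 1$, $\lim_{n\to\infty}m(n)\,|c_{m(n),n}|^{k/m(n)}=+\infty$ (in particular $m(n)\geq 1$ for all large $n$), and the sequence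 $(c_{k+m(n),n})_{n\ge 1}$ is bounded. - (R) There is $r>0$ such that $\lim_{n\to\infty}\min\{|P_n(z)|:|z|=r\}=+\infty$. Let $HC((P_n(D)))$ be the set of all $f\in H(\mathbb{C})$ whose orbit $\{P_n(D)f:n\ge 1\}$ is dense in $H(\mathbb{C})$. Then $HC((P_n(D)))$ is maximal dense-lineable in $H(\mathbb{C})$: there is a dense vector subspace $M$ of $H(\mathbb{C})$ with $\dim M=\dim H(\mathbb{C})$ and $M\subset HC((P_n(D)))\cup\{0\}$. Moreover $\dim H(\mathbb{C})=\mathfrak{c}$, the cardinality of the continuum. -/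

import Mathlib

noncomputable section

namespace EntireHC

open Filter Topology Polynomial

/-- The entire functions, as a linear subspace of the continuous functions `ℂ → ℂ`. -/
def entireSubmodule : Submodule ℂ C(ℂ, ℂ) where
  carrier := {f | Differentiable ℂ f}
  add_mem' hf hg := Differentiable.add hf hg
  zero_mem' := differentiable_const 0
  smul_mem' c _ hf := Differentiable.const_smul hf c

/-- The space `H(ℂ)` of entire functions. Its topology is induced by the compact-open topology of
`C(ℂ, ℂ)`, that is, the topology of uniform convergence on compacta. -/
def EntireFun : Type := entireSubmodule

instance : AddCommGroup EntireFun := inferInstanceAs (AddCommGroup entireSubmodule)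

instance : Module ℂ EntireFun := inferInstanceAs (Module ℂ entireSubmodule)

instance : TopologicalSpace EntireFun := inferInstanceAs (TopologicalSpace entireSubmodule)

instance : IsTopologicalAddGroup EntireFun :=
  inferInstanceAs (IsTopologicalAddGroup entireSubmodule)

instance : ContinuousSMul ℂ EntireFun := inferInstanceAs (ContinuousSMul ℂ entireSubmodule)

/-- The inclusion of `H(ℂ)` in the continuous functions. -/
def incl : EntireFun →ₗ[ℂ] C(ℂ, ℂ) := entireSubmodule.subtype

instance : CoeFun EntireFun fun _ => ℂ → ℂ := ⟨fun f => incl f⟩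

theorem ext_fun {f g : EntireFun} (h : ∀ z, f z = g z) : f = g :=
  Subtype.ext (ContinuousMap.ext h)

theorem differentiable (f : EntireFun) : Differentiable ℂ f := f.2

theorem isInducing_incl : IsInducing incl := IsInducing.subtypeVal

/-- The derivative of an entire function, as an entire function. -/
def derivFun (f : EntireFun) : EntireFun :=
  ⟨⟨deriv f, (differentiable f).deriv.continuous⟩, (differentiable f).deriv⟩

theorem continuous_derivFun : Continuous derivFun := by
  rw [isInducing_incl.continuous_iff, continuous_iff_continuousAt]
  intro f
  rw [ContinuousAt, ContinuousMap.tendsto_iff_tendstoLocallyUniformly,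
    ← tendstoLocallyUniformlyOn_univ]
  have h : Tendsto incl (𝓝 f) (𝓝 (incl f)) := isInducing_incl.continuous.continuousAt
  rw [ContinuousMap.tendsto_iff_tendstoLocallyUniformly, ← tendstoLocallyUniformlyOn_univ] at h
  exact h.deriv (Eventually.of_forall fun g => (differentiable g).differentiableOn) isOpen_univ

/-- The differentiation operator `D : H(ℂ) → H(ℂ)`. -/
def D : EntireFun →L[ℂ] EntireFun where
  toFun := derivFun
  map_add' f g := ext_fun fun z => deriv_add (differentiable f z) (differentiable g z)
  map_smul' c f := ext_fun fun z => deriv_const_mul c (differentiable f z)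
  cont := continuous_derivFun

/-- The differential operator `P(D) = ∑ j, c_j D ^ j` attached to `P = ∑ j, c_j z ^ j`. -/
def diffOp (P : ℂ[X]) : EntireFun →L[ℂ] EntireFun := aeval D P

theorem D_pow_apply (j : ℕ) (f : EntireFun) (z : ℂ) : ((D ^ j) f) z = iteratedDeriv j f z := by
  induction j generalizing f with
  | zero => rfl
  | succ j ih => rw [pow_succ, iteratedDeriv_succ']; exact ih (D f)

/-- `(P(D) f)(z) = ∑ j, c_j f^{(j)}(z)`. -/
theorem diffOp_apply (P : ℂ[X]) (f : EntireFun) (z : ℂ) :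
    (diffOp P f) z = ∑ j ∈ Finset.range (P.natDegree + 1), P.coeff j * iteratedDeriv j f z := by
  rw [diffOp, aeval_eq_sum_range, FunLike.coe_sum, Finset.sum_apply, map_sum,
    ContinuousMap.sum_apply]
  refine Finset.sum_congr rfl fun j _ => ?_
  rw [← D_pow_apply]
  rfl

/-- The set of hypercyclic vectors of a sequence of operators. -/
def hypercyclicVectors {X Y : Type*} [AddCommGroup X] [Module ℂ X] [TopologicalSpace X]
    [AddCommGroup Y] [Module ℂ Y] [TopologicalSpace Y] (T : ℕ → X →L[ℂ] Y) : Set X :=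
  {x | Dense (Set.range fun n => T n x)}

/-- `A` is maximal dense-lineable in the complex topological vector space `X`. -/
def IsMaximalDenseLineable {X : Type*} [AddCommGroup X] [Module ℂ X] [TopologicalSpace X]
    (A : Set X) : Prop :=
  ∃ M : Submodule ℂ X, Dense (M : Set X) ∧ Module.rank ℂ M = Module.rank ℂ X ∧
    (M : Set X) ⊆ A ∪ {0}

/-- The class of entire functions of exponential type. -/
def IsExponentialType (f : ℂ → ℂ) : Prop :=
  Differentiable ℂ f ∧ ∃ A > 0, ∃ B > 0, ∀ z : ℂ, ‖f z‖ ≤ A * Real.exp (B * ‖z‖)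

/-- Uniqueness sets for the class of entire functions of exponential type. -/
def IsUnicitySet (U : Set ℂ) : Prop :=
  ∀ f : ℂ → ℂ, IsExponentialType f → (∀ z ∈ U, f z = 0) → ∀ z, f z = 0

/-- Property (P). -/
def PropertyP (P : ℕ → ℂ[X]) : Prop :=
  ∃ U : Set ℂ, IsUnicitySet U ∧ ∀ z ∈ U, Tendsto (fun n => ‖(P n).eval z‖) atTop atTop

/-- The valence (order of vanishing at the origin) of a nonzero polynomial. -/
def valence (P : ℂ[X]) : ℕ := P.natTrailingDegree

/-- Property (Q). -/
def PropertyQ (P : ℕ → ℂ[X]) : Prop :=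
  ∀ k : ℕ, 1 ≤ k →
    Tendsto (fun n => (valence (P n) : ℝ) *
      ‖(P n).coeff (valence (P n))‖ ^ ((k : ℝ) / (valence (P n) : ℝ))) atTop atTop ∧
    ∃ C : ℝ, ∀ n, ‖(P n).coeff (k + valence (P n))‖ ≤ C

/-- Property (R). The infimum over the circle is a minimum, by compactness. -/
def PropertyR (P : ℕ → ℂ[X]) : Prop :=
  ∃ r : ℝ, 0 < r ∧
    Tendsto (fun n => sInf ((fun z : ℂ => ‖(P n).eval z‖) '' Metric.sphere 0 r)) atTop atTop

end EntireHC

end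

/-!
The set of hypercyclic vectors is handled by a criterion for Fréchet spaces `X`
(`isMaximalDenseLineable_of_mixing`). Let `F` be a filter on the indices such that, along `F`, the
operators `T n` are eventually zero at each vector of a dense set, and map every neighbourhood of
zero eventually onto a set meeting any given nonempty open set. Then one finds, recursively, indices
`n k` and rapidly decreasing vectors `x k` such that `T (n k)` kills `x j` for `j < k`, sends `x k`
close to a prescribed vector `y k`, and is tiny on `x j` for `j > k`. Hence
`T (n k) (∑ j, a j • x j) ≈ a k • y k` for every bounded scalar sequence `a`. Let the index `k` encode a pair consisting of
a member of a dense sequence (this is `y k`) and of a finite binary word. Each infinite binary word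
`t` gives a sequence `a`: the indicator of the initial segments of `t`. Since two infinite words
share only finitely many initial segments, a nonzero combination of these sequences equals a nonzero
constant infinitely often above each member of the dense sequence, so the corresponding series is
hypercyclic. This yields a subspace of dimension `𝔠`; adding to the series vectors annihilated by
almost all `T n` does not disturb hypercyclicity and makes the subspace dense.

For `T n = P_n(D)` the filter `F` is chosen so that the index and the valence tend to infinity. Then
polynomials are eventually annihilated, and mixing follows from right inverses tending to zero on a
set with dense span (`mixing_of_approx_rightInverse`).

* Under `PropertyP` the set consists of the exponentials `exp (a z)` with `a` in the uniqueness set: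
  they are eigenvectors with eigenvalue `P_n(a)`. Their span is dense because the Fourier–Borel
  transform `a ↦ φ (exp (a z))` of a continuous functional `φ` is of exponential type and determines
  `φ` (`dense_span_expFun`).
* `PropertyR` implies `PropertyP`, since circles are uniqueness sets.
* Under `PropertyQ` the set consists of the monomials. The equation `P_n(D) x = z ^ k / k!` is
  solved by recursion on `k`, and the solutions are small because `m ^ m / m! ≤ e ^ m`
  (`PropertyQ.exists_rightInverse`).
-/

noncomputable section

namespace EntireHC

open Filter Topology Polynomial

/-! ### Dense subspaces of hypercyclic vectors in Fréchet spaces -/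

section Abstract

variable {X : Type*} [AddCommGroup X] [Module ℂ X] [TopologicalSpace X] {p : ℕ → Seminorm ℂ X}

/-- Recursive choice of a sequence when every choice is constrained by the finite set of the
previous ones. -/
theorem exists_seq_of_forall_finset {α : Type*} (P : ℕ → α → Prop) (r : ℕ → α → α → Prop)
    (h : ∀ k (s : Finset α), ∃ a, P k a ∧ ∀ b ∈ s, r k b a) :
    ∃ f : ℕ → α, (∀ k, P k (f k)) ∧ ∀ k, ∀ j < k, r k (f j) (f k) := by
  classical
  choose F hF using h
  let S : ℕ → Finset α := fun k => Nat.rec ∅ (fun k s => insert (F k s) s) k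
  have hS : ∀ k, S (k + 1) = insert (F k (S k)) (S k) := fun k => rfl
  refine ⟨fun k => F k (S k), fun k => (hF k _).1, fun k j hj => (hF k _).2 _ ?_⟩
  induction k with
  | zero => omega
  | succ k ih =>
    rw [hS, Finset.mem_insert]
    rcases Nat.lt_succ_iff_lt_or_eq.1 hj with hlt | rfl
    · exact Or.inr (ih hlt)
    · exact Or.inl rfl

/-- The building blocks: small vectors `x k` such that `T (n k)` sends `x k` close to the prescribed
`y k`, annihilates the earlier blocks and keeps the later ones small. -/
theorem exists_block_sequence (hp : WithSeminorms p) {T : ℕ → X →L[ℂ] X} {F : Filter ℕ} [F.NeBot]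
    [F.IsCountablyGenerated] (h0 : Dense {x | ∀ᶠ n in F, T n x = 0})
    (hmix : ∀ U ∈ 𝓝 (0 : X), ∀ V : Set X, IsOpen V → V.Nonempty → ∀ᶠ n in F, ∃ x ∈ U, T n x ∈ V)
    (y : ℕ → X) :
    ∃ (n : ℕ → ℕ) (x : ℕ → X), Tendsto n atTop F ∧ (∀ k, p k (x k) ≤ (1 / 4) ^ k) ∧
      (∀ k, p k (T (n k) (x k) - y k) ≤ (1 / 4) ^ k) ∧
      (∀ k, ∀ j < k, p k (T (n j) (x k)) ≤ (1 / 4) ^ k) ∧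
      ∀ k, ∀ j < k, T (n k) (x j) = 0 := by
  have hg := hp.topologicalAddGroup
  obtain ⟨B, hB⟩ := F.exists_antitone_basis
  obtain ⟨f, hf, hr⟩ := exists_seq_of_forall_finset
    (α := ℕ × {x : X // ∀ᶠ n in F, T n x = 0})
    (fun k a => a.1 ∈ B k ∧ p k a.2.1 ≤ (1 / 4) ^ k ∧ p k (T a.1 a.2.1 - y k) ≤ (1 / 4) ^ k)
    (fun k b a => p k (T b.1 a.2.1) ≤ (1 / 4) ^ k ∧ T a.1 b.2.1 = 0) (by
      intro k s
      have hε : (0 : ℝ) < (1 / 4) ^ k := by positivity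
      have hpc : Continuous (p k) := hp.continuous_seminorm k
      let U : Set X := {x | p k x < (1 / 4) ^ k} ∩ ⋂ b ∈ s, {x | p k (T b.1 x) < (1 / 4) ^ k}
      have hU : IsOpen U := (isOpen_lt hpc continuous_const).inter <|
        isOpen_biInter_finset fun b _ => isOpen_lt (hpc.comp (T b.1).continuous) continuous_const
      have hU0 : (0 : X) ∈ U := by simp [U]
      let V : Set X := {z | p k (z - y k) < (1 / 4) ^ k}
      have hV : IsOpen V := isOpen_lt (hpc.comp (continuous_id.sub continuous_const))
        continuous_const
      have hVy : y k ∈ V := by simp [V]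
      have hs : ∀ᶠ n in F, ∀ b ∈ s, T n b.2.1 = 0 :=
        (Finset.eventually_all s).2 fun b _ => b.2.2
      obtain ⟨n, ⟨hnB, hns⟩, x, hxU, hxV⟩ :=
        (((show ∀ᶠ n in F, n ∈ B k from hB.mem k).and hs).and
          (hmix U (hU.mem_nhds hU0) V hV ⟨_, hVy⟩)).exists
      obtain ⟨x', ⟨hx'U, hx'V⟩, hx'⟩ := h0.inter_open_nonempty (U ∩ T n ⁻¹' V)
        (hU.inter (hV.preimage (T n).continuous)) ⟨x, hxU, hxV⟩
      refine ⟨(n, ⟨x', hx'⟩), ⟨hnB, hx'U.1.le, (show p k _ < _ from hx'V).le⟩,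
        fun b hb => ⟨?_, hns b hb⟩⟩
      exact (show p k _ < _ from Set.mem_iInter₂.1 hx'U.2 b hb).le)
  exact ⟨fun k => (f k).1, fun k => (f k).2.1, hB.tendsto fun k => (hf k).1, fun k => (hf k).2.1,
    fun k => (hf k).2.2, fun k j hj => (hr k j hj).1, fun k j hj => (hr k j hj).2⟩

theorem seminorm_hasSum_le (hp : WithSeminorms p) {R : ℕ} {f : ℕ → X} {g : X} {b : ℕ → ℝ} {c : ℝ}
    (hf : HasSum f g) (hb : ∀ k, p R (f k) ≤ b k) (hc : HasSum b c) : p R g ≤ c := by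
  have h := ((hp.continuous_seminorm R).tendsto g).comp hf
  refine le_of_tendsto h (Eventually.of_forall fun s => ?_)
  have hb0 : ∀ k, 0 ≤ b k := fun k => (apply_nonneg _ _).trans (hb k)
  calc p R (∑ k ∈ s, f k) ≤ ∑ k ∈ s, p R (f k) := Finset.le_sum_of_subadditive (p R) (map_zero _).le
        (map_add_le_add _) s f
    _ ≤ ∑ k ∈ s, b k := Finset.sum_le_sum fun k _ => hb k
    _ ≤ c := sum_le_hasSum s (fun k _ => hb0 k) hc

/-- Almost-disjointness device: the indicator of the finite words that are initial segments of the
infinite word `t`. Two distinct infinite words have only finitely many initial segments in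
common. -/
def prefixIndicator (t : ℕ → Bool) (l : List Bool) : ℂ :=
  if l = (List.range l.length).map t then 1 else 0

theorem prefixIndicator_self (t : ℕ → Bool) (L : ℕ) :
    prefixIndicator t ((List.range L).map t) = 1 := by
  simp [prefixIndicator]

theorem norm_prefixIndicator_le (t : ℕ → Bool) (l : List Bool) : ‖prefixIndicator t l‖ ≤ 1 := by
  unfold prefixIndicator
  split_ifs <;> simp

theorem eventually_prefixIndicator_eq_zero {t t' : ℕ → Bool} (h : t' ≠ t) :
    ∀ᶠ L in atTop, prefixIndicator t' ((List.range L).map t) = 0 := by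
  obtain ⟨i, hi⟩ := Function.ne_iff.1 h
  filter_upwards [eventually_gt_atTop i] with L hL
  rw [prefixIndicator, if_neg]
  intro hEq
  simp only [List.length_map, List.length_range, List.map_inj_left, List.mem_range] at hEq
  exact hi (hEq i hL).symm

/-- A nonzero combination of prefix indicators takes a fixed nonzero value on all sufficiently long
initial segments of some infinite word. -/
theorem exists_eventually_sum_prefixIndicator {c : (ℕ → Bool) →₀ ℂ} (hc : c ≠ 0) :
    ∃ t, c t ≠ 0 ∧ ∀ᶠ L in atTop,
      ∑ t' ∈ c.support, c t' * prefixIndicator t' ((List.range L).map t) = c t := by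
  obtain ⟨t, ht⟩ := Finsupp.support_nonempty_iff.2 hc
  refine ⟨t, Finsupp.mem_support_iff.1 ht, ?_⟩
  have h : ∀ᶠ L in atTop, ∀ t' ∈ c.support, t' ≠ t →
      prefixIndicator t' ((List.range L).map t) = 0 := by
    refine (Finset.eventually_all c.support).2 fun t' _ => ?_
    by_cases h : t' = t
    · exact Eventually.of_forall fun _ h' => absurd h h'
    · exact (eventually_prefixIndicator_eq_zero h).mono fun _ hL _ => hL
  filter_upwards [h] with L hL
  rw [Finset.sum_eq_single_of_mem t ht fun t' ht' hne => by rw [hL t' ht' hne, mul_zero],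
    prefixIndicator_self, mul_one]

/-- Let `X` be a separable Fréchet space of cardinality at most `𝔠`, with completeness expressed by
the convergence of absolutely convergent series. If, along some countably generated filter, the
operators `T n` are mixing and eventually zero at each vector of a dense set, then the set of
hypercyclic vectors is maximal dense-lineable.

The subspace is spanned by the vectors `∑ k, a k • x k + u`, where the `x k` are the building blocks
of `exists_block_sequence`, the coefficients `a` are prefix indicators of infinite words, and
`u` runs over the vectors annihilated by almost all `T n`. -/
theorem isMaximalDenseLineable_of_mixing {X : Type} [AddCommGroup X] [Module ℂ X]
    [TopologicalSpace X] {p : ℕ → Seminorm ℂ X} [T2Space X] [Nontrivial X]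
    [TopologicalSpace.SeparableSpace X] (hp : WithSeminorms p) (hmono : Monotone p)
    (hsum : ∀ x : ℕ → X, (∀ R, Summable fun k => p R (x k)) → Summable x)
    (hcard : Cardinal.mk X ≤ Cardinal.continuum)
    {T : ℕ → X →L[ℂ] X} {F : Filter ℕ} [F.NeBot] [F.IsCountablyGenerated]
    (h0 : Dense {x | ∀ᶠ n in F, T n x = 0})
    (hmix : ∀ U ∈ 𝓝 (0 : X), ∀ V : Set X, IsOpen V → V.Nonempty →
      ∀ᶠ n in F, ∃ x ∈ U, T n x ∈ V) :
    IsMaximalDenseLineable (hypercyclicVectors T) ∧ Module.rank ℂ X = Cardinal.continuum := by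
  have hg := hp.topologicalAddGroup
  have hsm := hp.continuousSMul
  let d : ℕ → X := TopologicalSpace.denseSeq X
  have hd : DenseRange d := TopologicalSpace.denseRange_denseSeq X
  obtain ⟨σ⟩ : Nonempty (ℕ ≃ ℕ × List Bool) := nonempty_equiv_of_countable
  obtain ⟨n, x, hn, hx, hTx, hlate, hearly⟩ :=
    exists_block_sequence hp h0 hmix fun k => d (σ k).1
  have hxR : ∀ R, Summable fun k => p R (x k) := fun R => by
    refine summable_of_isBigO_nat (g := fun k : ℕ => (1 / 4 : ℝ) ^ k)
      (summable_geometric_of_lt_one (by norm_num) (by norm_num)) ?_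
    refine Asymptotics.IsBigO.of_bound 1 ?_
    filter_upwards [eventually_ge_atTop R] with k hk
    rw [Real.norm_of_nonneg (apply_nonneg _ _), Real.norm_of_nonneg (by positivity), one_mul]
    exact (hmono hk (x k)).trans (hx k)
  have hsx : ∀ (a : ℕ → ℂ) (A : ℝ), (∀ k, ‖a k‖ ≤ A) → Summable fun k => a k • x k :=
    fun a A ha => hsum _ fun R => by
      refine Summable.of_nonneg_of_le (fun _ => apply_nonneg _ _) (fun k => ?_)
        ((hxR R).mul_left A)
      rw [map_smul_eq_mul]
      exact mul_le_mul_of_nonneg_right (ha k) (apply_nonneg _ _)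
  -- `T (n j)` sends a series with bounded coefficients almost to the multiple `a j` of its target;
  -- splitting `(1 / 4) ^ k ≤ (1 / 2) ^ j * (1 / 2) ^ k` for `k ≥ j` makes the error small in `j`
  have hT : ∀ (a : ℕ → ℂ) (A : ℝ) (g : X), (∀ k, ‖a k‖ ≤ A) → HasSum (fun k => a k • x k) g →
      Tendsto (fun j => T (n j) g - a j • d (σ j).1) atTop (𝓝 0) := by
    intro a A g ha hg'
    have hA : 0 ≤ A := (norm_nonneg _).trans (ha 0)
    rw [hp.tendsto_nhds_atTop]
    intro R ε hε
    have hlim : Tendsto (fun j : ℕ => (1 / 2 : ℝ) ^ j * A * 2) atTop (𝓝 0) := by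
      simpa using ((tendsto_pow_atTop_nhds_zero_of_lt_one (r := (1 / 2 : ℝ)) (by norm_num)
        (by norm_num)).mul_const A).mul_const 2
    obtain ⟨N, hN⟩ := eventually_atTop.1 ((hlim.eventually (gt_mem_nhds hε)).and
      (eventually_ge_atTop R))
    refine ⟨N, fun j hj => ?_⟩
    obtain ⟨hjε, hjR⟩ := hN j hj
    rw [sub_zero]
    refine lt_of_le_of_lt ?_ hjε
    refine (hmono hjR _).trans ?_
    have hs := ((hg'.mapL (T (n j))).sub (hasSum_ite_eq j (a j • d (σ j).1)))
    refine seminorm_hasSum_le hp hs (b := fun k => (1 / 2 : ℝ) ^ j * A * (1 / 2) ^ k)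
      (fun k => ?_) ((hasSum_geometric_two).mul_left _)
    have hquarter : ∀ k, j ≤ k → (1 / 4 : ℝ) ^ k ≤ (1 / 2) ^ j * (1 / 2) ^ k := fun k hk => by
      rw [show (1 / 4 : ℝ) = 1 / 2 * (1 / 2) by norm_num, mul_pow]
      gcongr ?_ * _
      exact pow_le_pow_of_le_one (by norm_num) (by norm_num) hk
    have key : ∀ k, ∀ v : X, j ≤ k → p k v ≤ (1 / 4) ^ k →
        p j (a k • v) ≤ (1 / 2 : ℝ) ^ j * A * (1 / 2) ^ k := fun k v hk hv => by
      rw [map_smul_eq_mul]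
      calc ‖a k‖ * p j v ≤ A * ((1 / 2) ^ j * (1 / 2) ^ k) :=
            mul_le_mul (ha k) ((hmono hk v).trans (hv.trans (hquarter k hk))) (apply_nonneg _ _) hA
        _ = _ := by ring
    rcases lt_trichotomy k j with hk | rfl | hk
    · rw [if_neg hk.ne, sub_zero, map_smul, hearly j k hk, smul_zero, map_zero]
      positivity
    · rw [if_pos rfl, map_smul, ← smul_sub]
      exact key k _ le_rfl (hTx k)
    · rw [if_neg hk.ne', sub_zero, map_smul]
      exact key k _ hk.le (hlate k j hk)
  -- the vectors annihilated by almost all `T n` form a subspace, which is enumerated by `u`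
  let X₀ : Submodule ℂ X :=
    { carrier := {x | ∀ᶠ n in F, T n x = 0}
      add_mem' := fun {v w} hv hw => by
        filter_upwards [hv, hw] with i hi hi'
        rw [map_add, hi, hi', add_zero]
      zero_mem' := Eventually.of_forall fun i => map_zero _
      smul_mem' := fun c v hv => by
        filter_upwards [hv] with i hi
        rw [map_smul, hi, smul_zero] }
  have hwords : Cardinal.mk (ℕ → Bool) = Cardinal.continuum := by simp
  obtain ⟨e⟩ : Nonempty (X₀ ↪ (ℕ → Bool)) := by
    rw [← Cardinal.le_def, hwords]
    exact (Cardinal.mk_set_le (X₀ : Set X)).trans hcard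
  let u : (ℕ → Bool) → X₀ := Function.invFun e
  have hu : Function.Surjective u := Function.invFun_surjective e.injective
  let a : (ℕ → Bool) → ℕ → ℂ := fun t k => prefixIndicator t (σ k).2
  let f : (ℕ → Bool) → X := fun t => ∑' k, a t k • x k
  have hf : ∀ t, HasSum (fun k => a t k • x k) (f t) := fun t =>
    (hsx (a t) 1 fun k => norm_prefixIndicator_le _ _).hasSum
  let g : (ℕ → Bool) → X := fun t => f t + u t
  have hyper : ∀ c : (ℕ → Bool) →₀ ℂ, c ≠ 0 →
      Dense (Set.range fun i => T i (Finsupp.linearCombination ℂ g c)) := by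
    intro c hc
    obtain ⟨t₀, ht₀, hev⟩ := exists_eventually_sum_prefixIndicator hc
    let b : ℕ → ℂ := fun k => ∑ t ∈ c.support, c t * a t k
    have hb : ∀ k, ‖b k‖ ≤ ∑ t ∈ c.support, ‖c t‖ := fun k =>
      norm_sum_le_of_le _ fun t _ => by
        rw [norm_mul]
        exact mul_le_of_le_one_right (norm_nonneg _) (norm_prefixIndicator_le _ _)
    let v : X := ∑ t ∈ c.support, c t • (u t : X)
    have hv : ∀ᶠ i in F, T i v = 0 :=
      X₀.sum_mem fun t _ => X₀.smul_mem _ (u t).2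
    have hdec : Finsupp.linearCombination ℂ g c = ∑ t ∈ c.support, c t • f t + v := by
      rw [Finsupp.linearCombination_apply, Finsupp.sum, ← Finset.sum_add_distrib]
      exact Finset.sum_congr rfl fun t _ => smul_add _ _ _
    have hser : HasSum (fun k => b k • x k) (∑ t ∈ c.support, c t • f t) := by
      have := hasSum_sum (s := c.support) fun t _ => (hf t).const_smul (c t)
      refine this.congr_fun ?_
      intro k
      simp only [b, Finset.sum_smul, mul_smul]
    have hlim := hT b _ _ hb hser
    have hcl : ∀ i, c t₀ • d i ∈ closure (Set.range fun j =>
        T j (Finsupp.linearCombination ℂ g c)) := by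
      intro i
      have hlim' := hlim.add_const (c t₀ • d i)
      rw [zero_add] at hlim'
      refine mem_closure_of_frequently_of_tendsto ?_ hlim'
      -- the indices attached to the target `d i` and to the initial segments of `t₀`
      let k : ℕ → ℕ := fun L => σ.symm (i, (List.range L).map t₀)
      have hk : Tendsto k atTop atTop := by
        refine Function.Injective.nat_tendsto_atTop fun L L' h => ?_
        have := congrArg List.length (Prod.ext_iff.1 (σ.symm.injective h)).2
        simpa using this
      refine hk.frequently (Eventually.frequently ?_)
      filter_upwards [hev, hk.eventually (hn.eventually hv)] with L hL hvL
      have hbk : b (k L) = c t₀ := by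
        simpa [b, a, k] using hL
      refine ⟨n (k L), ?_⟩
      have hσ : (σ (k L)).1 = i := by simp [k]
      simp only [hdec, map_add, hvL, hbk, hσ]
      abel
    have hdense : DenseRange fun i => c t₀ • d i :=
      (Homeomorph.smulOfNeZero (c t₀) ht₀).surjective.denseRange.comp hd
        (Homeomorph.smulOfNeZero (c t₀) ht₀).continuous
    exact Dense.of_closure (hdense.mono (Set.range_subset_iff.2 hcl))
  have hli : LinearIndependent ℂ g := by
    rw [linearIndependent_iff]
    intro c hc
    by_contra hne
    have := hyper c hne
    simp only [hc, map_zero, Set.range_const] at this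
    obtain ⟨w, hw⟩ := exists_ne (0 : X)
    have hw' := this w
    rw [closure_singleton] at hw'
    exact hw hw'
  have hrank : Module.rank ℂ (Submodule.span ℂ (Set.range g)) = Cardinal.continuum := by
    rw [rank_span hli, Cardinal.mk_range_eq g hli.injective, hwords]
  have hrankX : Module.rank ℂ X = Cardinal.continuum :=
    le_antisymm ((rank_le_card ℂ X).trans hcard) (hrank ▸ Submodule.rank_le _)
  refine ⟨⟨Submodule.span ℂ (Set.range g), ?_, hrank.trans hrankX.symm, ?_⟩, hrankX⟩
  · refine Dense.of_closure (h0.mono fun q hq => ?_)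
    choose t ht using fun i : ℕ => hu (((i : ℂ) + 1) • ⟨q, hq⟩)
    have hne : ∀ i : ℕ, (i : ℂ) + 1 ≠ 0 := fun i => Nat.cast_add_one_ne_zero i
    have hmem : ∀ i : ℕ, ((i : ℂ) + 1)⁻¹ • f (t i) + q ∈ Submodule.span ℂ (Set.range g) := by
      intro i
      have : ((i : ℂ) + 1)⁻¹ • f (t i) + q = ((i : ℂ) + 1)⁻¹ • g (t i) := by
        simp only [g, ht, smul_add, Submodule.coe_smul, inv_smul_smul₀ (hne i)]
      rw [this]
      exact Submodule.smul_mem _ _ (Submodule.subset_span ⟨_, rfl⟩)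
    refine mem_closure_of_tendsto (b := atTop) ?_ (Eventually.of_forall hmem)
    rw [show 𝓝 q = 𝓝 (0 + q) by rw [zero_add]]
    refine Tendsto.add_const q ?_
    rw [hp.tendsto_nhds_atTop]
    intro R ε hε
    -- the series `f t` are bounded uniformly in the word `t`
    have hbd : ∀ t, p R (f t) ≤ ∑' k, p R (x k) := fun t =>
      seminorm_hasSum_le hp (hf t) (fun k => by
        rw [map_smul_eq_mul]
        exact mul_le_of_le_one_left (apply_nonneg _ _) (norm_prefixIndicator_le _ _))
        (hxR R).hasSum
    have hlim : Tendsto (fun i : ℕ => 1 / ((i : ℝ) + 1) * ∑' k, p R (x k)) atTop (𝓝 0) := by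
      simpa using tendsto_one_div_add_atTop_nhds_zero_nat.mul_const (∑' k, p R (x k))
    obtain ⟨N, hN⟩ := eventually_atTop.1 (hlim.eventually (gt_mem_nhds hε))
    refine ⟨N, fun i hi => lt_of_le_of_lt ?_ (hN i hi)⟩
    have hnorm : ‖((i : ℂ) + 1)⁻¹‖ = 1 / ((i : ℝ) + 1) := by
      rw [norm_inv, one_div, ← Nat.cast_add_one, Complex.norm_natCast, Nat.cast_add_one]
    rw [sub_zero, map_smul_eq_mul, hnorm]
    exact mul_le_mul_of_nonneg_left (hbd _) (by positivity)
  · intro m hm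
    obtain ⟨c, rfl⟩ := (Finsupp.mem_span_range_iff_exists_finsupp (R := ℂ)).1 hm
    by_cases hc : c = 0
    · exact Or.inr (by simp [hc])
    · exact Or.inl (hyper c hc)

end Abstract

/-! ### The Fréchet space of entire functions -/

theorem incl_add_apply (f g : EntireFun) (z : ℂ) : (f + g) z = f z + g z := rfl

theorem incl_smul_apply (c : ℂ) (f : EntireFun) (z : ℂ) : (c • f) z = c * f z := rfl

theorem incl_sub_apply (f g : EntireFun) (z : ℂ) : (f - g) z = f z - g z := rfl

theorem incl_sum_apply {ι : Type*} (s : Finset ι) (f : ι → EntireFun) (z : ℂ) :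
    (∑ i ∈ s, f i) z = ∑ i ∈ s, f i z := by
  rw [map_sum, ContinuousMap.sum_apply]

/-- The entire function with a given underlying function. -/
def EntireFun.mk (f : ℂ → ℂ) (hf : Differentiable ℂ f) : EntireFun := ⟨⟨f, hf.continuous⟩, hf⟩

@[simp] theorem EntireFun.mk_apply (f : ℂ → ℂ) (hf : Differentiable ℂ f) (z : ℂ) :
    (EntireFun.mk f hf) z = f z := rfl

instance : T2Space EntireFun := inferInstanceAs (T2Space entireSubmodule)

instance : SecondCountableTopology EntireFun :=
  isInducing_incl.secondCountableTopology

instance : Nontrivial EntireFun := by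
  refine ⟨EntireFun.mk (fun _ => 1) (differentiable_const _), 0, fun h => ?_⟩
  have := congrArg (fun f : EntireFun => f 0) h
  exact one_ne_zero this

theorem tendsto_iff {ι : Type*} {u : ι → EntireFun} {l : Filter ι} {f : EntireFun} :
    Tendsto u l (𝓝 f) ↔ ∀ R : ℕ,
      TendstoUniformlyOn (fun i z => u i z) f l (Metric.closedBall 0 R) := by
  rw [isInducing_incl.tendsto_nhds_iff,
    ContinuousMap.tendsto_iff_forall_isCompact_tendstoUniformlyOn]
  refine ⟨fun h R => h _ (isCompact_closedBall 0 _), fun h K hK => ?_⟩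
  obtain ⟨r, hr⟩ := hK.isBounded.subset_closedBall 0
  obtain ⟨R, hR⟩ := exists_nat_ge r
  exact (h R).mono (hr.trans (Metric.closedBall_subset_closedBall hR))

/-- The seminorm `f ↦ sup {|f z| : |z| ≤ R}`, written as the norm of the restriction of `f` to the
compact disc. -/
def supSeminorm (R : ℕ) : Seminorm ℂ EntireFun :=
  (normSeminorm ℂ C(Metric.closedBall (0 : ℂ) R, ℂ)).comp
    ({ toFun := fun f => (incl f).restrict (Metric.closedBall (0 : ℂ) R)
       map_add' := fun f g => ContinuousMap.ext fun z => incl_add_apply f g z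
       map_smul' := fun c f => ContinuousMap.ext fun z => incl_smul_apply c f z } :
      EntireFun →ₗ[ℂ] C(Metric.closedBall (0 : ℂ) R, ℂ))

theorem supSeminorm_le_iff {R : ℕ} {f : EntireFun} {c : ℝ} (hc : 0 ≤ c) :
    supSeminorm R f ≤ c ↔ ∀ z : ℂ, ‖z‖ ≤ R → ‖f z‖ ≤ c := by
  refine (ContinuousMap.norm_le ((incl f).restrict (Metric.closedBall (0 : ℂ) R)) hc).trans ?_
  simp only [Subtype.forall, Metric.mem_closedBall, dist_zero_right]
  rfl

theorem norm_le_supSeminorm {R : ℕ} (f : EntireFun) {z : ℂ} (hz : ‖z‖ ≤ R) :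
    ‖f z‖ ≤ supSeminorm R f :=
  (supSeminorm_le_iff (apply_nonneg _ _)).1 le_rfl z hz

theorem supSeminorm_mono : Monotone supSeminorm := fun _ _ hRS f =>
  (supSeminorm_le_iff (apply_nonneg _ _)).2 fun _ hz =>
    norm_le_supSeminorm f (hz.trans (Nat.cast_le.2 hRS))

theorem tendsto_iff_supSeminorm {ι : Type*} {u : ι → EntireFun} {l : Filter ι} {f : EntireFun} :
    Tendsto u l (𝓝 f) ↔ ∀ R, Tendsto (fun i => supSeminorm R (u i - f)) l (𝓝 0) := by
  rw [tendsto_iff]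
  refine forall_congr' fun R => ?_
  rw [Metric.tendstoUniformlyOn_iff, Metric.tendsto_nhds]
  constructor
  · intro h ε hε
    filter_upwards [h (ε / 2) (by positivity)] with i hi
    rw [Real.dist_0_eq_abs, abs_of_nonneg (apply_nonneg _ _)]
    refine lt_of_le_of_lt ((supSeminorm_le_iff (by positivity)).2 fun z hz => ?_) (half_lt_self hε)
    rw [incl_sub_apply, ← dist_eq_norm, dist_comm]
    exact (hi z (by simpa using hz)).le
  · intro h ε hε
    filter_upwards [h ε hε] with i hi z hz
    rw [Real.dist_0_eq_abs, abs_of_nonneg (apply_nonneg _ _)] at hi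
    rw [dist_comm, dist_eq_norm, ← incl_sub_apply]
    exact (norm_le_supSeminorm _ (by simpa using hz)).trans_lt hi

theorem withSeminorms_supSeminorm : WithSeminorms supSeminorm := by
  rw [SeminormFamily.withSeminorms_iff_nhds_eq_iInf]
  have h0 : ∀ R, Tendsto (supSeminorm R) (𝓝 0) (𝓝 0) := fun R => by
    simpa using tendsto_iff_supSeminorm.1 (tendsto_id (x := 𝓝 (0 : EntireFun))) R
  refine le_antisymm (le_iInf fun R => (h0 R).le_comap) ?_
  refine (tendsto_iff_supSeminorm (u := id)).2 fun R => ?_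
  simp only [id, sub_zero]
  exact tendsto_comap.mono_left (iInf_le (fun R => (𝓝 0).comap (supSeminorm R)) R)

instance : LocallyConvexSpace ℝ EntireFun := withSeminorms_supSeminorm.toLocallyConvexSpace

/-- `H(ℂ)` is complete: absolutely convergent series converge. -/
theorem summable_of_summable_supSeminorm (x : ℕ → EntireFun)
    (hx : ∀ R, Summable fun k => supSeminorm R (x k)) : Summable x := by
  have hu : ∀ R : ℕ, TendstoUniformlyOn (fun (s : Finset ℕ) z => ∑ k ∈ s, x k z)
      (fun z => ∑' k, x k z) atTop (Metric.closedBall 0 R) := fun R =>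
    tendstoUniformlyOn_tsum (hx R) fun k z hz => norm_le_supSeminorm _ (by simpa using hz)
  have hd : Differentiable ℂ fun z => ∑' k, x k z := by
    intro z
    obtain ⟨R, hR⟩ := exists_nat_gt ‖z‖
    have := ((hu R).mono Metric.ball_subset_closedBall).tendstoLocallyUniformlyOn.differentiableOn
      (Eventually.of_forall fun s => (Differentiable.fun_sum fun k _ =>
        differentiable (x k)).differentiableOn) Metric.isOpen_ball
    exact (this z (by simpa using hR)).differentiableAt
      (Metric.isOpen_ball.mem_nhds (by simpa using hR))
  refine ⟨EntireFun.mk _ hd, ?_⟩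
  rw [HasSum, SummationFilter.unconditional_filter]
  refine tendsto_iff.2 fun R => ?_
  simp only [incl_sum_apply]
  exact hu R

theorem mk_entireFun_le : Cardinal.mk EntireFun ≤ Cardinal.continuum := by
  have hinj : Function.Injective
      (fun (f : EntireFun) (k : ℕ) => f (TopologicalSpace.denseSeq ℂ k)) := fun f g h =>
    ext_fun fun z => congrFun (Continuous.ext_on (TopologicalSpace.denseRange_denseSeq ℂ)
      (differentiable f).continuous (differentiable g).continuous
      (by rintro _ ⟨k, rfl⟩; exact congrFun h k)) z
  refine (Cardinal.mk_le_of_injective hinj).trans ?_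
  simp

/-! ### Monomials and exponentials -/

/-- The normalized monomial `z ^ k / k!`; the differentiation operator is a shift on these. -/
def monom (k : ℕ) : EntireFun :=
  EntireFun.mk (fun z => z ^ k / (k.factorial : ℂ)) (by fun_prop)

/-- The exponential `z ↦ exp (a z)`, an eigenvector of the differentiation operator. -/
def expFun (a : ℂ) : EntireFun := EntireFun.mk (fun z => Complex.exp (a * z)) (by fun_prop)

theorem D_apply (f : EntireFun) (z : ℂ) : (D f) z = deriv f z := rfl

theorem D_monom_zero : D (monom 0) = 0 := ext_fun fun z => by
  rw [D_apply]
  change deriv (fun z : ℂ => z ^ 0 / (Nat.factorial 0 : ℂ)) z = 0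
  simp

theorem D_monom_succ (k : ℕ) : D (monom (k + 1)) = monom k := ext_fun fun z => by
  rw [D_apply]
  change deriv (fun z : ℂ => z ^ (k + 1) / (Nat.factorial (k + 1) : ℂ)) z
    = z ^ k / (Nat.factorial k : ℂ)
  have h1 : (Nat.factorial k : ℂ) ≠ 0 := Nat.cast_ne_zero.2 k.factorial_ne_zero
  have h2 : (k : ℂ) + 1 ≠ 0 := Nat.cast_add_one_ne_zero k
  rw [deriv_div_const, deriv_pow_field, Nat.factorial_succ]
  push_cast
  field_simp

theorem D_pow_monom (j k : ℕ) : (D ^ j) (monom k) = if j ≤ k then monom (k - j) else 0 := by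
  induction j generalizing k with
  | zero => simp
  | succ j ih =>
    rw [pow_succ, mul_apply_eq_comp]
    cases k with
    | zero => rw [D_monom_zero, map_zero, if_neg (by omega)]
    | succ k =>
      rw [D_monom_succ, ih]
      simp [Nat.add_sub_add_right]

theorem diffOp_eq_sum {P : ℂ[X]} {N : ℕ} (hN : P.natDegree < N) (f : EntireFun) :
    diffOp P f = ∑ j ∈ Finset.range N, P.coeff j • (D ^ j) f := by
  rw [diffOp, aeval_eq_sum_range' hN, FunLike.coe_sum, Finset.sum_apply]
  rfl

/-- The action of `P(D)` on monomials. -/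
theorem diffOp_monom (P : ℂ[X]) (k : ℕ) :
    diffOp P (monom k) = ∑ j ∈ Finset.range (k + 1), P.coeff j • monom (k - j) := by
  rw [diffOp_eq_sum (N := k + 1 + (P.natDegree + 1)) (by omega), Finset.sum_range_add]
  have h1 : ∀ j ∈ Finset.range (k + 1), P.coeff j • (D ^ j) (monom k)
      = P.coeff j • monom (k - j) := fun j hj => by
    rw [D_pow_monom, if_pos (by simpa [Nat.lt_succ_iff] using hj)]
  have h2 : ∀ j ∈ Finset.range (P.natDegree + 1),
      P.coeff (k + 1 + j) • (D ^ (k + 1 + j)) (monom k) = 0 := fun j _ => by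
    rw [D_pow_monom, if_neg (by omega), smul_zero]
  rw [Finset.sum_congr rfl h1, Finset.sum_eq_zero h2, add_zero]

/-- `P(D)` annihilates the monomials of degree below the valence of `P`. -/
theorem diffOp_monom_eq_zero {P : ℂ[X]} {k : ℕ} (hk : k < valence P) : diffOp P (monom k) = 0 := by
  rw [diffOp_monom]
  refine Finset.sum_eq_zero fun j hj => ?_
  rw [coeff_eq_zero_of_lt_natTrailingDegree, zero_smul]
  exact lt_of_le_of_lt (by simpa [Nat.lt_succ_iff] using hj) hk

theorem diffOp_monom_add_valence (P : ℂ[X]) (k : ℕ) :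
    diffOp P (monom (k + valence P)) =
      ∑ i ∈ Finset.range (k + 1), P.coeff (i + valence P) • monom (k - i) := by
  rw [diffOp_monom, show k + valence P + 1 = valence P + (k + 1) by omega, Finset.sum_range_add,
    Finset.sum_eq_zero, zero_add]
  · refine Finset.sum_congr rfl fun i _ => ?_
    rw [add_comm (valence P) i, Nat.add_sub_add_right]
  · intro j hj
    rw [coeff_eq_zero_of_lt_natTrailingDegree, zero_smul]
    simpa [valence] using hj

theorem D_expFun (a : ℂ) : D (expFun a) = a • expFun a := ext_fun fun z => by
  rw [D_apply]
  change deriv (fun z => Complex.exp (a * z)) z = a * Complex.exp (a * z)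
  have := ((hasDerivAt_id z).const_mul a).cexp
  simpa [mul_comm] using this.deriv

theorem diffOp_expFun (P : ℂ[X]) (a : ℂ) : diffOp P (expFun a) = P.eval a • expFun a := by
  have h : ∀ j, (D ^ j) (expFun a) = a ^ j • expFun a := fun j => by
    induction j with
    | zero => simp
    | succ j ih =>
      rw [pow_succ, mul_apply_eq_comp, D_expFun, map_smul, ih, smul_smul, pow_succ']
  rw [diffOp_eq_sum (Nat.lt_succ_self _), eval_eq_sum_range, Finset.sum_smul]
  simp only [h, smul_smul]

theorem supSeminorm_monom_le (R k : ℕ) : supSeminorm R (monom k) ≤ (R : ℝ) ^ k / k.factorial := by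
  refine (supSeminorm_le_iff (by positivity)).2 fun z hz => ?_
  change ‖z ^ k / (k.factorial : ℂ)‖ ≤ _
  rw [norm_div, norm_pow, Complex.norm_natCast]
  gcongr

theorem hasSum_monom_expFun (a : ℂ) : HasSum (fun k => a ^ k • monom k) (expFun a) := by
  have hs : Summable fun k => a ^ k • monom k := by
    refine summable_of_summable_supSeminorm _ fun R => ?_
    refine Summable.of_nonneg_of_le (fun _ => apply_nonneg _ _) (fun k => ?_)
      (Real.summable_pow_div_factorial (‖a‖ * R))
    rw [map_smul_eq_mul, norm_pow, mul_pow, mul_div_assoc]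
    exact mul_le_mul_of_nonneg_left (supSeminorm_monom_le R k) (by positivity)
  obtain ⟨g, hg⟩ := hs
  convert hg
  refine ext_fun fun z => ?_
  have hev : Tendsto (fun f : EntireFun => f z) (𝓝 g) (𝓝 (g z)) :=
    ((continuous_eval_const (F := C(ℂ, ℂ)) z).comp isInducing_incl.continuous).tendsto g
  have h1 : HasSum (fun k => a ^ k * (z ^ k / (k.factorial : ℂ))) (g z) := by
    have := hev.comp hg
    refine this.congr fun s => ?_
    rw [Function.comp_apply, incl_sum_apply]
    rfl
  have h2 := NormedSpace.exp_series_hasSum_exp' (𝕂 := ℂ) (a * z)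
  rw [← Complex.exp_eq_exp_ℂ] at h2
  refine h2.unique ?_
  refine h1.congr_fun fun k => ?_
  rw [smul_eq_mul, mul_pow]
  ring

/-- The monomials span a dense subspace: Taylor polynomials converge locally uniformly. -/
theorem dense_span_monom : Dense (Submodule.span ℂ (Set.range monom) : Set EntireFun) := by
  intro f
  have hps := (differentiable f).hasFPowerSeriesOnBall 0 (R := 1) one_pos
  set q := cauchyPowerSeries f 0 (1 : NNReal)
  let u : ℕ → EntireFun := fun N => ∑ k ∈ Finset.range N, (q.coeff k * (k.factorial : ℂ)) • monom k
  refine mem_closure_of_tendsto (f := u) (b := atTop) ?_ (Eventually.of_forall fun N =>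
    Submodule.sum_mem _ fun k _ => Submodule.smul_mem _ _ (Submodule.subset_span ⟨k, rfl⟩))
  have hloc := hps.tendstoLocallyUniformlyOn
  have hu : ∀ N z, u N z = q.partialSum N z := fun N z => by
    rw [incl_sum_apply, FormalMultilinearSeries.partialSum]
    refine Finset.sum_congr rfl fun k _ => ?_
    rw [incl_smul_apply, FormalMultilinearSeries.apply_eq_pow_smul_coeff, smul_eq_mul]
    change _ * (z ^ k / (k.factorial : ℂ)) = _
    have : (k.factorial : ℂ) ≠ 0 := Nat.cast_ne_zero.2 k.factorial_ne_zero
    field_simp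
  refine tendsto_iff.2 fun R => ?_
  simp only [hu]
  have h1 := (tendstoLocallyUniformlyOn_iff_forall_isCompact Metric.isOpen_eball).1 hloc
    (Metric.closedBall 0 R) (by simp) (isCompact_closedBall 0 _)
  simpa using h1

/-! ### Approximate right inverses and mixing -/

/-- If approximate right inverses tending to zero exist on a set with dense span, then the sequence
of operators is mixing near zero. -/
theorem mixing_of_approx_rightInverse {X : Type*} [AddCommGroup X] [Module ℂ X]
    [TopologicalSpace X] [IsTopologicalAddGroup X] [ContinuousSMul ℂ X] {T : ℕ → X →L[ℂ] X}
    {F : Filter ℕ} {S : Set X} (hS : Dense (Submodule.span ℂ S : Set X))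
    (h : ∀ y ∈ S, ∃ x : ℕ → X, Tendsto x F (𝓝 0) ∧ Tendsto (fun n => T n (x n)) F (𝓝 y)) :
    ∀ U ∈ 𝓝 (0 : X), ∀ V : Set X, IsOpen V → V.Nonempty → ∀ᶠ n in F, ∃ x ∈ U, T n x ∈ V := by
  intro U hU V hV hVne
  obtain ⟨y, hyV, hy⟩ := hS.inter_open_nonempty V hV hVne
  suffices ∃ x : ℕ → X, Tendsto x F (𝓝 0) ∧ Tendsto (fun n => T n (x n)) F (𝓝 y) by
    obtain ⟨x, hx, hTx⟩ := this
    filter_upwards [hx hU, hTx (hV.mem_nhds hyV)] with n h1 h2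
    exact ⟨x n, h1, h2⟩
  clear hyV
  induction hy using Submodule.span_induction with
  | mem y hy => exact h y hy
  | zero => exact ⟨fun _ => 0, tendsto_const_nhds, by simp [tendsto_const_nhds]⟩
  | add y z _ _ hy hz =>
    obtain ⟨x, hx, hTx⟩ := hy
    obtain ⟨w, hw, hTw⟩ := hz
    refine ⟨fun n => x n + w n, by simpa using hx.add hw, ?_⟩
    simpa using hTx.add hTw
  | smul c y _ hy =>
    obtain ⟨x, hx, hTx⟩ := hy
    refine ⟨fun n => c • x n, by simpa using hx.const_smul c, ?_⟩
    simpa using hTx.const_smul c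

theorem tendsto_smul_zero_of_bounded {l : Filter ℕ} {b : ℕ → ℂ} {C : ℝ} (hb : ∀ n, ‖b n‖ ≤ C)
    {v : ℕ → EntireFun} (hv : Tendsto v l (𝓝 0)) : Tendsto (fun n => b n • v n) l (𝓝 0) := by
  rw [tendsto_iff_supSeminorm] at hv ⊢
  intro R
  have h := (hv R).const_mul C
  rw [mul_zero] at h
  refine squeeze_zero (fun _ => apply_nonneg _ _) (fun n => ?_) h
  rw [sub_zero, sub_zero, map_smul_eq_mul]
  exact mul_le_mul_of_nonneg_right (hb n) (apply_nonneg _ _)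

/-! ### Uniqueness sets and the density of exponentials -/

theorem exists_norm_le_supSeminorm (φ : EntireFun →L[ℂ] ℂ) :
    ∃ C : ℝ, 0 < C ∧ ∃ R : ℕ, ∀ f, ‖φ f‖ ≤ C * supSeminorm R f := by
  obtain ⟨s, C, hC, h⟩ := Seminorm.bound_of_continuous withSeminorms_supSeminorm
    ((normSeminorm ℂ ℂ).comp (φ : EntireFun →ₗ[ℂ] ℂ)) (continuous_norm.comp φ.continuous)
  refine ⟨C, by positivity, s.sup id, fun f => (h f).trans ?_⟩
  have hs : s.sup supSeminorm ≤ supSeminorm (s.sup id) :=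
    Finset.sup_le fun i hi => supSeminorm_mono (Finset.le_sup (f := id) hi)
  exact mul_le_mul_of_nonneg_left (hs f) C.2

/-- The Fourier–Borel transform `a ↦ φ (exp (a ·))` of a continuous functional has the power series
with coefficients `φ (z ^ k / k!)`. -/
theorem hasFPowerSeriesOnBall_fourierBorel (φ : EntireFun →L[ℂ] ℂ) :
    HasFPowerSeriesOnBall (fun a => φ (expFun a))
      (FormalMultilinearSeries.ofScalars ℂ fun k => φ (monom k)) 0 ⊤ := by
  obtain ⟨C, hC, R, hφ⟩ := exists_norm_le_supSeminorm φ
  refine ⟨?_, ENNReal.zero_lt_top, fun {a} _ => ?_⟩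
  · refine (FormalMultilinearSeries.radius_eq_top_of_summable_norm _ fun r => ?_).ge
    refine Summable.of_nonneg_of_le (fun _ => by positivity) (fun k => ?_)
      ((Real.summable_pow_div_factorial (R * r)).mul_left C)
    rw [FormalMultilinearSeries.ofScalars_norm, mul_pow]
    calc ‖φ (monom k)‖ * (r : ℝ) ^ k ≤ C * ((R : ℝ) ^ k / k.factorial) * (r : ℝ) ^ k := by
          gcongr
          exact (hφ _).trans (mul_le_mul_of_nonneg_left (supSeminorm_monom_le R k) hC.le)
      _ = _ := by ring
  · have h := (hasSum_monom_expFun a).mapL φ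
    rw [zero_add]
    refine h.congr_fun fun k => ?_
    rw [FormalMultilinearSeries.ofScalars_apply_eq, map_smul, smul_eq_mul, smul_eq_mul, mul_comm]

theorem isExponentialType_fourierBorel (φ : EntireFun →L[ℂ] ℂ) :
    IsExponentialType fun a => φ (expFun a) := by
  refine ⟨?_, ?_⟩
  · have := (hasFPowerSeriesOnBall_fourierBorel φ).differentiableOn
    rwa [Metric.eball_top, differentiableOn_univ] at this
  · obtain ⟨C, hC, R, hφ⟩ := exists_norm_le_supSeminorm φ
    refine ⟨C, hC, R + 1, by positivity, fun a => (hφ _).trans ?_⟩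
    refine mul_le_mul_of_nonneg_left ((supSeminorm_le_iff (by positivity)).2 fun z hz => ?_) hC.le
    change ‖Complex.exp (a * z)‖ ≤ _
    refine (Complex.norm_exp_le_exp_norm _).trans (Real.exp_le_exp.2 ?_)
    rw [norm_mul, mul_comm]
    gcongr
    linarith

/-- By Hahn–Banach, a functional vanishing on the exponentials with frequencies in a uniqueness set
has vanishing Fourier–Borel transform, so it kills all monomials. -/
theorem dense_span_expFun {U : Set ℂ} (hU : IsUnicitySet U) :
    Dense (Submodule.span ℂ (expFun '' U) : Set EntireFun) := by
  set S := (Submodule.span ℂ (expFun '' U)).topologicalClosure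
  intro f
  by_contra hf
  have hconv : Convex ℝ (S : Set EntireFun) := (S.restrictScalars ℝ).convex
  obtain ⟨φ, r, hlt, hr⟩ := RCLike.geometric_hahn_banach_closed_point (𝕜 := ℂ) hconv
    (Submodule.isClosed_topologicalClosure _) hf
  have hφS : ∀ g ∈ S, φ g = 0 := fun g hg => by
    by_contra hne
    -- rescale `g` so that the functional attains the separating value `r`
    have h := hlt _ (S.smul_mem ((r : ℂ) / φ g) hg)
    rw [map_smul, smul_eq_mul, div_mul_cancel₀ _ hne] at h
    simp at h
  have hr0 : 0 < r := by simpa using hlt 0 S.zero_mem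
  have hFB := isExponentialType_fourierBorel φ
  have hzero : ∀ a, φ (expFun a) = 0 := hU _ hFB fun a ha =>
    hφS _ (Submodule.le_topologicalClosure _ (Submodule.subset_span ⟨a, ha, rfl⟩))
  have hmonom : ∀ k, φ (monom k) = 0 := by
    have := (hasFPowerSeriesOnBall_fourierBorel φ).hasFPowerSeriesAt.eq_zero_of_eventually
      (Eventually.of_forall hzero)
    exact congrFun ((FormalMultilinearSeries.ofScalars_series_eq_zero ℂ).1 this)
  have hφ0 : φ f = 0 := by
    have hker : Submodule.span ℂ (Set.range monom) ≤ LinearMap.ker (φ : EntireFun →ₗ[ℂ] ℂ) := by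
      rw [Submodule.span_le]
      rintro _ ⟨k, rfl⟩
      exact hmonom k
    have hcl : IsClosed {g | φ g = 0} := isClosed_eq φ.continuous continuous_const
    exact closure_minimal (fun g hg => hker hg) hcl (dense_span_monom f)
  rw [hφ0] at hr
  simp at hr
  exact absurd hr hr0.not_gt

/-- Circles are uniqueness sets for all entire functions. -/
theorem isUnicitySet_sphere {r : ℝ} (hr : 0 < r) : IsUnicitySet (Metric.sphere 0 r) := by
  intro f hf h0 z
  have hpre : IsPreconnected (Metric.sphere (0 : ℂ) r) :=
    isPreconnected_sphere (by rw [Complex.rank_real_complex]; norm_num) 0 r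
  have hmem : (r : ℂ) ∈ Metric.sphere (0 : ℂ) r := by simp [abs_of_pos hr]
  have hnt : (Metric.sphere (0 : ℂ) r).Nontrivial := by
    refine ⟨r, hmem, -r, by simp [abs_of_pos hr], fun h => ?_⟩
    have : (r : ℂ) = 0 := by linear_combination h / 2
    exact hr.ne' (Complex.ofReal_eq_zero.1 this)
  have hacc := hpre.preperfect_of_nontrivial hnt _ hmem
  have hfreq : ∃ᶠ w in 𝓝[≠] (r : ℂ), f w = 0 :=
    ((accPt_iff_frequently_nhdsNE).1 hacc).mono h0
  have han : AnalyticOnNhd ℂ f Set.univ := fun w _ => hf.1.analyticAt w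
  exact congrFun (han.eq_of_frequently_eq (fun w _ => analyticAt_const) hfreq) z

theorem PropertyR.propertyP {P : ℕ → ℂ[X]} (h : PropertyR P) : PropertyP P := by
  obtain ⟨r, hr, h⟩ := h
  refine ⟨_, isUnicitySet_sphere hr, fun z hz => tendsto_atTop_mono (fun n => ?_) h⟩
  exact csInf_le ⟨0, by rintro _ ⟨w, _, rfl⟩; exact norm_nonneg _⟩ ⟨z, hz, rfl⟩

/-- On exponentials, `P(D)` is inverted by division by the eigenvalue. -/
theorem PropertyP.mixing {P : ℕ → ℂ[X]} (h : PropertyP P) {F : Filter ℕ} (hF : F ≤ atTop) :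
    ∀ U ∈ 𝓝 (0 : EntireFun), ∀ V : Set EntireFun, IsOpen V → V.Nonempty →
      ∀ᶠ n in F, ∃ x ∈ U, diffOp (P n) x ∈ V := by
  obtain ⟨U, hU, h⟩ := h
  refine mixing_of_approx_rightInverse (dense_span_expFun hU) ?_
  rintro _ ⟨a, ha, rfl⟩
  have hlim := (h a ha).mono_left hF
  refine ⟨fun n => ((P n).eval a)⁻¹ • expFun a, ?_, ?_⟩
  · have : Tendsto (fun n => ((P n).eval a)⁻¹) F (𝓝 0) :=
      tendsto_inv₀_cobounded.comp (tendsto_norm_atTop_iff_cobounded.1 hlim)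
    simpa using this.smul_const (expFun a)
  · refine tendsto_const_nhds.congr' ?_
    filter_upwards [hlim.eventually_gt_atTop 0] with n hn
    rw [map_smul, diffOp_expFun, inv_smul_smul₀ (norm_pos_iff.1 hn)]

/-! ### Small right inverses under the coefficient condition -/

/-- The estimate `m ^ m / m! ≤ e ^ m` turns the growth condition on the lowest coefficient into
smallness of the normalized monomials. -/
theorem inv_pow_mul_pow_div_factorial_le {m K k : ℕ} {x S : ℝ} (hm : 1 ≤ m) (hx : 0 ≤ x)
    (hS : 1 ≤ S) (h : 2 * Real.exp 1 * S ≤ m * x ^ ((K : ℝ) / m)) :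
    (x ^ K)⁻¹ * (S ^ (k + m) / (k + m).factorial) ≤ S ^ k * (1 / 2) ^ m := by
  have hm0 : (0 : ℝ) < m := by exact_mod_cast hm
  have hL : 0 < 2 * Real.exp 1 * S := by positivity
  have hpow : (x ^ ((K : ℝ) / m)) ^ m = x ^ K := by
    rw [← Real.rpow_mul_natCast hx, div_mul_cancel₀ _ hm0.ne', Real.rpow_natCast]
  have h1 : (2 * Real.exp 1 * S / m) ^ m ≤ x ^ K := by
    rw [← hpow]
    gcongr
    rwa [div_le_iff₀' hm0]
  have h2 : (x ^ K)⁻¹ ≤ (m / (2 * Real.exp 1 * S)) ^ m := by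
    rw [← inv_div, inv_pow]
    exact inv_anti₀ (by positivity) h1
  have h3 : S ^ (k + m) / (k + m).factorial ≤ S ^ k * S ^ m / m.factorial := by
    rw [pow_add]
    gcongr
    omega
  have h4 : (m : ℝ) ^ m / m.factorial ≤ Real.exp 1 ^ m := by
    rw [← Real.exp_nat_mul, mul_one]
    exact Real.pow_div_factorial_le_exp _ hm0.le m
  calc (x ^ K)⁻¹ * (S ^ (k + m) / (k + m).factorial)
      ≤ (m / (2 * Real.exp 1 * S)) ^ m * (S ^ k * S ^ m / m.factorial) := by gcongr
    _ = S ^ k * (1 / (2 * Real.exp 1)) ^ m * ((m : ℝ) ^ m / m.factorial) := by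
        have : S ≠ 0 := by positivity
        rw [div_pow, div_pow, mul_pow _ S]
        field_simp
        rw [one_pow]
    _ ≤ S ^ k * (1 / (2 * Real.exp 1)) ^ m * Real.exp 1 ^ m := by gcongr
    _ = S ^ k * (1 / 2) ^ m := by
        rw [mul_assoc, ← mul_pow]
        congr 2
        field_simp

theorem PropertyQ.tendsto_monom {P : ℕ → ℂ[X]} (h : PropertyQ P) {F : Filter ℕ} (hF : F ≤ atTop)
    (hm : Tendsto (fun n => valence (P n)) F atTop) (K k : ℕ) :
    Tendsto (fun n => (((P n).coeff (valence (P n)))⁻¹) ^ (K + 1) • monom (k + valence (P n)))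
      F (𝓝 0) := by
  rw [tendsto_iff_supSeminorm]
  intro R
  have hlim : Tendsto (fun n => ((R : ℝ) + 1) ^ k * (1 / 2) ^ valence (P n)) F (𝓝 0) := by
    simpa using ((tendsto_pow_atTop_nhds_zero_of_lt_one (r := (1 / 2 : ℝ)) (by norm_num)
      (by norm_num)).comp hm).const_mul (((R : ℝ) + 1) ^ k)
  refine squeeze_zero' (Eventually.of_forall fun _ => apply_nonneg _ _) ?_ hlim
  filter_upwards [hm.eventually_ge_atTop 1,
    ((h (K + 1) (by omega)).1.mono_left hF).eventually_ge_atTop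
      (2 * Real.exp 1 * ((R : ℝ) + 1))] with n hn1 hn
  have hR : (0 : ℝ) ≤ R := R.cast_nonneg
  refine le_trans ?_ (inv_pow_mul_pow_div_factorial_le (k := k) hn1 (norm_nonneg _)
    (by linarith) hn)
  rw [sub_zero, map_smul_eq_mul, norm_pow, norm_inv, inv_pow]
  gcongr
  refine (supSeminorm_monom_le _ _).trans ?_
  gcongr
  linarith

/-- The equation `P(D) x = z ^ k / k!` is solved recursively by inverting the lowest-order term of
`P(D)`. The recursion divides by the lowest coefficient repeatedly, whence the claim about all
of its inverse powers. -/
theorem PropertyQ.exists_rightInverse {P : ℕ → ℂ[X]} (hP : ∀ n, P n ≠ 0) (h : PropertyQ P)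
    {F : Filter ℕ} (hF : F ≤ atTop) (hm : Tendsto (fun n => valence (P n)) F atTop) (k : ℕ) :
    ∃ x : ℕ → EntireFun,
      (∀ K, Tendsto (fun n => (((P n).coeff (valence (P n)))⁻¹) ^ K • x n) F (𝓝 0)) ∧
        ∀ n, diffOp (P n) (x n) = monom k := by
  induction k using Nat.strong_induction_on with
  | _ k ih =>
    choose! y hy hTy using ih
    let c : ℕ → ℂ := fun n => (P n).coeff (valence (P n))
    have hc : ∀ n, c n ≠ 0 := fun n => by
      have := trailingCoeff_nonzero_iff_nonzero.2 (hP n)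
      exact this
    refine ⟨fun n => (c n)⁻¹ • (monom (k + valence (P n)) - ∑ i ∈ Finset.range k,
      (P n).coeff (i + 1 + valence (P n)) • y (k - (i + 1)) n), fun K => ?_, fun n => ?_⟩
    · have hsum : Tendsto (fun n => ∑ i ∈ Finset.range k, (P n).coeff (i + 1 + valence (P n)) •
          (c n)⁻¹ ^ (K + 1) • y (k - (i + 1)) n) F (𝓝 0) := by
        rw [← Finset.sum_const_zero (s := Finset.range k)]
        refine tendsto_finsetSum _ fun i hi => ?_
        obtain ⟨C, hC⟩ := (h (i + 1) (by omega)).2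
        exact tendsto_smul_zero_of_bounded hC
          (hy _ (by have := Finset.mem_range.1 hi; omega) (K + 1))
      have := (h.tendsto_monom hF hm K k).sub hsum
      rw [sub_zero] at this
      refine this.congr fun n => ?_
      rw [smul_smul, ← pow_succ, smul_sub, Finset.smul_sum]
      congr 1
      exact Finset.sum_congr rfl fun i _ => smul_comm _ _ _
    · have hsum : diffOp (P n) (∑ i ∈ Finset.range k,
          (P n).coeff (i + 1 + valence (P n)) • y (k - (i + 1)) n) = ∑ i ∈ Finset.range k,
          (P n).coeff (i + 1 + valence (P n)) • monom (k - (i + 1)) := by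
        rw [map_sum]
        refine Finset.sum_congr rfl fun i hi => ?_
        rw [map_smul, hTy _ (by have := Finset.mem_range.1 hi; omega)]
      rw [map_smul, map_sub, hsum, diffOp_monom_add_valence, Finset.sum_range_succ',
        add_sub_cancel_left, zero_add, Nat.sub_zero, inv_smul_smul₀ (hc n)]

theorem PropertyQ.mixing {P : ℕ → ℂ[X]} (hP : ∀ n, P n ≠ 0) (h : PropertyQ P)
    {F : Filter ℕ} (hF : F ≤ atTop) (hm : Tendsto (fun n => valence (P n)) F atTop) :
    ∀ U ∈ 𝓝 (0 : EntireFun), ∀ V : Set EntireFun, IsOpen V → V.Nonempty →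
      ∀ᶠ n in F, ∃ x ∈ U, diffOp (P n) x ∈ V := by
  refine mixing_of_approx_rightInverse dense_span_monom ?_
  rintro _ ⟨k, rfl⟩
  obtain ⟨x, hx, hTx⟩ := h.exists_rightInverse hP hF hm k
  exact ⟨x, by simpa using hx 0, by simp only [hTx]; exact tendsto_const_nhds⟩

theorem dense_eventually_diffOp_eq_zero {P : ℕ → ℂ[X]} {F : Filter ℕ}
    (hm : Tendsto (fun n => valence (P n)) F atTop) :
    Dense {x : EntireFun | ∀ᶠ n in F, diffOp (P n) x = 0} := by
  refine dense_span_monom.mono fun f hf => ?_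
  induction hf using Submodule.span_induction with
  | mem f hf =>
    obtain ⟨k, rfl⟩ := hf
    filter_upwards [hm.eventually_gt_atTop k] with n hn
    exact diffOp_monom_eq_zero hn
  | zero => exact Eventually.of_forall fun n => map_zero _
  | add f g _ _ hf hg =>
    filter_upwards [hf, hg] with n h1 h2
    rw [map_add, h1, h2, add_zero]
  | smul c f _ hf =>
    filter_upwards [hf] with n h1
    rw [map_smul, h1, smul_zero]

end EntireHC

end

theorem theorem3p2 (P : ℕ → Polynomial ℂ)
    (hP : ∀ n, 0 < (P n).natDegree)
    (ha : ¬ BddAbove (Set.range fun n => EntireHC.valence (P n)))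
    (hb : EntireHC.PropertyP P ∨ EntireHC.PropertyQ P ∨ EntireHC.PropertyR P) :
    EntireHC.IsMaximalDenseLineable
        (EntireHC.hypercyclicVectors fun n => EntireHC.diffOp (P n)) ∧
      Module.rank ℂ EntireHC.EntireFun = Cardinal.continuum := by
  have hne : ∀ n, P n ≠ 0 := fun n h => by simpa [h] using hP n
  -- the filter of indices tending to infinity along which the valence tends to infinity as well
  let F : Filter ℕ := Filter.atTop ⊓ Filter.comap (fun n => EntireHC.valence (P n)) Filter.atTop
  have hF : F ≤ Filter.atTop := inf_le_left
  have hm : Filter.Tendsto (fun n => EntireHC.valence (P n)) F Filter.atTop :=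
    Filter.tendsto_comap.mono_left inf_le_right
  have hbot : F.NeBot := by
    rw [((Filter.atTop_basis (α := ℕ)).inf (Filter.atTop_basis.comap _)).neBot_iff]
    rintro ⟨N, v⟩ _
    by_contra hempty
    refine ha ((((Set.finite_lt_nat N).image fun n => EntireHC.valence (P n)).bddAbove.union
      (bddAbove_Iic (a := v))).mono ?_)
    rintro _ ⟨n, rfl⟩
    rcases lt_or_ge n N with hn | hn
    · exact Or.inl ⟨n, hn, rfl⟩
    · refine Or.inr (Set.mem_Iic.2 <| not_lt.1 fun hv => hempty ⟨n, hn, hv.le⟩)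
  have hmix : ∀ U ∈ nhds (0 : EntireHC.EntireFun), ∀ V : Set EntireHC.EntireFun, IsOpen V →
      V.Nonempty → ∀ᶠ n in F, ∃ x ∈ U, EntireHC.diffOp (P n) x ∈ V := by
    rcases hb with h | h | h
    · exact h.mixing hF
    · exact h.mixing hne hF hm
    · exact h.propertyP.mixing hF
  exact EntireHC.isMaximalDenseLineable_of_mixing EntireHC.withSeminorms_supSeminorm
    EntireHC.supSeminorm_mono EntireHC.summable_of_summable_supSeminorm EntireHC.mk_entireFun_le
    (EntireHC.dense_eventually_diffOp_eq_zero hm) hmix
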